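/- Let $n \ge 2$, let $E = E^n = \{x \in \mathbb{R}^n : \|x\| \le 1\}$ be the closed Euclidean unit ball with boundary $\partial E = \{x \in \mathbb{R}^n : \|x\| = 1\}$, and let $f : E \to \mathbb{R}$ be a continuous function. A contour of $f$ is a connected component of a level set $f^{-1}(y)$ for some $y \in \mathbb{R}$. Then $f$ has a contour $C$ such that (i) if $n = 2$, then $\operatorname{diam}(C \cap \partial E) \ge \sqrt{3}$; (ii) if $n \ge 3$, then $\operatorname{diam}(C \cap \partial E) = 2$. Here $\operatorname{diam}$ denotes the diameter with respect to the Euclidean distance. -/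

import Mathlib

/-- A contour of a map `f : X → Y` is a connected component of a level set `f ⁻¹' {y}`, for some
`y : Y`. (The components of a set are the components of its points, so contours are nonempty.) -/
def IsContour {X Y : Type*} [TopologicalSpace X] (f : X → Y) (C : Set X) : Prop :=
  ∃ y : Y, ∃ x ∈ f ⁻¹' {y}, C = connectedComponentIn (f ⁻¹' {y}) x

/-- The closed unit ball of `ℝⁿ` with its Euclidean metric. -/
abbrev unitBall (n : ℕ) : Set (EuclideanSpace ℝ (Fin n)) :=
  Metric.closedBall 0 1

/-! Call a pair of boundary points wide if it is antipodal (`n ≥ 3`) or at angle at least 2π/3, that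
is, at distance at least √3 (`n = 2`). Suppose that no contour contains a wide pair. Every closed G
without wide pairs then has a distinguished "big" complementary component β(G), antitone in G. For
`n = 2`, G ∩ ∂E lies in an open arc of length 2π/3, and β(G) contains the rest of the circle. For `n
≥ 3`, a Borsuk–Ulam argument gives an antipodally symmetric component of ∂E minus G ∪ -G, and β(G)
contains it.

Compactness and upper semicontinuity of contours give a contour C with β(C) minimal. Arbitrarily
near C there is a contour C' that separates C from a point of β(C) ∩ β(C'). Hence β(C') misses C, so
β(C') ⊆ β(C), with equality by minimality. The frontier of this set lies in C ∩ C' = ∅, so it is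
clopen, contradicting connectedness of E. This is `CircleLifts.exists_contourAt_rel`.

The topological input is `CircleLifts`, the vanishing of first cohomology. On the ball it makes
minimal closed separators connected, which produces C'. On the sphere it gives both the Borsuk–Ulam
theorem for maps to ℂ and the uniqueness of the big component. The circle lacks the property, hence
the separate argument for `n = 2`. -/

open Set Filter Topology

/-- Every continuous map from `X` to the circle lifts to the real line. -/
def CircleLifts (X : Type*) [TopologicalSpace X] : Prop :=
  ∀ θ : C(X, Circle), ∃ φ : C(X, ℝ), ∀ x, θ x = Circle.exp (φ x)

/-! ### Components of subsets. -/

section Components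

variable {X : Type*} [TopologicalSpace X]

theorem closure_connectedComponentIn_inter_subset [LocallyConnectedSpace X] {U : Set X}
    (hU : IsOpen U) (x : X) :
    closure (connectedComponentIn U x) ∩ U ⊆ connectedComponentIn U x := by
  rintro y ⟨hy, hyU⟩
  obtain ⟨z, hz, hz'⟩ := mem_closure_iff.1 hy _ (hU.connectedComponentIn (x := y))
    (mem_connectedComponentIn hyU)
  rw [connectedComponentIn_eq hz', ← connectedComponentIn_eq hz]
  exact mem_connectedComponentIn hyU

theorem isClosed_connectedComponentIn {F : Set X} (hF : IsClosed F) (x : X) :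
    IsClosed (connectedComponentIn F x) := by
  by_cases hx : x ∈ F
  · refine isClosed_of_closure_subset ?_
    exact isPreconnected_connectedComponentIn.closure.subset_connectedComponentIn
      (subset_closure (mem_connectedComponentIn hx))
      (closure_minimal (connectedComponentIn_subset _ _) hF)
  · rw [connectedComponentIn_eq_empty hx]
    exact isClosed_empty

theorem mem_of_mem_connectedComponentIn {F : Set X} {x y : X}
    (h : y ∈ connectedComponentIn F x) : x ∈ F :=
  connectedComponentIn_nonempty_iff.1 ⟨y, h⟩

theorem subset_connectedComponentIn_of_mem {F S : Set X} {x y : X}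
    (hS : IsPreconnected S) (hSF : S ⊆ F) (hy : y ∈ S) (hyx : y ∈ connectedComponentIn F x) :
    S ⊆ connectedComponentIn F x := by
  rw [connectedComponentIn_eq hyx]
  exact hS.subset_connectedComponentIn hy hSF

theorem mem_connectedComponentIn_symm {F : Set X} {x y : X}
    (h : y ∈ connectedComponentIn F x) : x ∈ connectedComponentIn F y := by
  rw [← connectedComponentIn_eq h]
  exact mem_connectedComponentIn (mem_of_mem_connectedComponentIn h)

theorem IsPreconnected.subset_of_disjoint_frontier {S O : Set X} (hS : IsPreconnected S)
    (hO : IsOpen O) (h : (S ∩ O).Nonempty) (hd : Disjoint S (frontier O)) : S ⊆ O := by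
  refine hS.subset_of_closure_inter_subset hO h fun z hz => ?_
  by_contra hzO
  exact disjoint_left.1 hd hz.2 ⟨hz.1, by rwa [hO.interior_eq]⟩

theorem joinedIn_of_mem_connectedComponentIn [LocallyPathConnectedSpace X] {U : Set X}
    (hU : IsOpen U) {x y : X} (h : y ∈ connectedComponentIn U x) : JoinedIn U x y := by
  have hx := mem_of_mem_connectedComponentIn h
  have hp : IsPathConnected (connectedComponentIn U x) :=
    (hU.connectedComponentIn.isConnected_iff_isPathConnected).1
      (isConnected_connectedComponentIn_iff.2 hx)
  exact (hp.joinedIn _ (mem_connectedComponentIn hx) _ h).mono (connectedComponentIn_subset _ _)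

end Components

/-! ### Separation and unicoherence from circle lifts. -/

section Separation

variable {X : Type*} [MetricSpace X]

open Metric in
/-- If two disjoint closed subsets of a space with trivial first cohomology do not separate two
points, then neither does their union. -/
theorem CircleLifts.mem_connectedComponentIn_union [LocallyConnectedSpace X] (hX : CircleLifts X)
    {F₁ F₂ : Set X} (h₁ : IsClosed F₁) (h₂ : IsClosed F₂) (hd : Disjoint F₁ F₂) {x y : X}
    (hy₁ : y ∈ connectedComponentIn F₁ᶜ x) (hy₂ : y ∈ connectedComponentIn F₂ᶜ x) :
    y ∈ connectedComponentIn (F₁ ∪ F₂)ᶜ x := by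
  classical
  rcases F₁.eq_empty_or_nonempty with rfl | hn₁
  · simpa using hy₂
  rcases F₂.eq_empty_or_nonempty with rfl | hn₂
  · simpa using hy₁
  by_contra hy
  have hW : IsOpen (F₁ ∪ F₂)ᶜ := (h₁.union h₂).isOpen_compl
  set U := connectedComponentIn (F₁ ∪ F₂)ᶜ x with hU
  have hx : x ∈ U := mem_connectedComponentIn (by
    have := mem_of_mem_connectedComponentIn hy₁
    have := mem_of_mem_connectedComponentIn hy₂
    simp_all)
  have hpos : ∀ z, 0 < infDist z F₁ + infDist z F₂ := fun z => by
    by_cases hz : z ∈ F₁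
    · have : 0 < infDist z F₂ :=
        (h₂.notMem_iff_infDist_pos hn₂).1 (disjoint_left.1 hd hz)
      linarith [infDist_nonneg (x := z) (s := F₁)]
    · have : 0 < infDist z F₁ := (h₁.notMem_iff_infDist_pos hn₁).1 hz
      linarith [infDist_nonneg (x := z) (s := F₂)]
  set u : X → ℝ := fun z => infDist z F₁ / (infDist z F₁ + infDist z F₂) with hu
  have huc : Continuous u := (continuous_infDist_pt _).div
    ((continuous_infDist_pt _).add (continuous_infDist_pt _)) fun z => (hpos z).ne'
  have hu0 : ∀ z, 0 ≤ u z := fun z => div_nonneg infDist_nonneg (hpos z).le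
  have hu1 : ∀ z, u z ≤ 1 := fun z => by
    rw [hu, div_le_one (hpos z)]; linarith [infDist_nonneg (x := z) (s := F₂)]
  have hF₁ : ∀ z, z ∈ F₁ ↔ u z = 0 := fun z => by
    rw [h₁.mem_iff_infDist_zero hn₁, hu, div_eq_zero_iff]
    simp [(hpos z).ne']
  have hF₂ : ∀ z, z ∈ F₂ ↔ u z = 1 := fun z => by
    rw [h₂.mem_iff_infDist_zero hn₂, hu, div_eq_one_iff_eq (hpos z).ne']
    constructor <;> intro h <;> linarith
  have hpi := Real.pi_pos
  -- The frontier of `U` lies in `F₁ ∪ F₂`, where `u` is 0 or 1, so πu and -πu agree there modulo 2π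
  -- and the sign change is invisible on the circle.
  let σ : X → ℝ := fun z => if z ∈ U then u z else - u z
  have hθ : Continuous fun z => Circle.exp (Real.pi * σ z) := by
    have : (fun z => Circle.exp (Real.pi * σ z)) =
        fun z => if z ∈ U then Circle.exp (Real.pi * u z) else Circle.exp (Real.pi * -u z) := by
      ext z; simp only [σ]; split_ifs <;> rfl
    rw [this]
    refine Continuous.if (fun a ha => ?_) (by fun_prop) (by fun_prop)
    have haF : a ∈ F₁ ∪ F₂ := by
      by_contra haF
      apply ha.2
      rw [show {x | x ∈ U} = U from rfl, hW.connectedComponentIn.interior_eq]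
      exact closure_connectedComponentIn_inter_subset hW x ⟨ha.1, haF⟩
    rcases haF with h | h
    · simp [(hF₁ a).1 h]
    · rw [(hF₂ a).1 h, Circle.exp_eq_exp]
      exact ⟨1, by push_cast; ring⟩
  obtain ⟨φ, hφ⟩ := hX ⟨_, hθ⟩
  have key : ∀ z, ∃ m : ℤ, φ z = Real.pi * σ z + m * (2 * Real.pi) := fun z =>
    Circle.exp_eq_exp.1 (hφ z).symm
  have hab : ∀ z, |σ z| = u z := fun z => by
    simp only [σ]; split_ifs <;> simp [abs_of_nonneg (hu0 z)]
  have no₁ : ∀ z ∈ F₁ᶜ, ∀ m : ℤ, φ z ≠ 2 * Real.pi * m := by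
    intro z hz m hm
    obtain ⟨k, hk⟩ := key z
    have h1 : σ z = 2 * (m - k : ℤ) := by
      push_cast
      refine mul_left_cancel₀ hpi.ne' ?_
      linarith
    have h2 : |σ z| ≤ 1 := (hab z).trans_le (hu1 z)
    rw [h1, abs_le] at h2
    have h3 : m - k = 0 := by
      have a1 : (-1 : ℝ) < (m - k : ℤ) := by linarith
      have a2 : ((m - k : ℤ) : ℝ) < 1 := by linarith
      norm_cast at a1 a2
      omega
    apply hz
    rw [hF₁, ← hab, h1, h3]; simp
  have no₂ : ∀ z ∈ F₂ᶜ, ∀ m : ℤ, φ z ≠ 2 * Real.pi * m + Real.pi := by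
    intro z hz m hm
    obtain ⟨k, hk⟩ := key z
    have h1 : σ z = 2 * (m - k : ℤ) + 1 := by
      push_cast
      refine mul_left_cancel₀ hpi.ne' ?_
      linarith
    have h2 : |σ z| ≤ 1 := (hab z).trans_le (hu1 z)
    have h2' := h2
    rw [h1, abs_le] at h2
    have h3 : m - k = 0 ∨ m - k = -1 := by
      have a1 : (-2 : ℝ) < (m - k : ℤ) := by linarith
      have a2 : ((m - k : ℤ) : ℝ) < 1 := by linarith
      norm_cast at a1 a2
      omega
    apply hz
    rw [hF₂, ← hab, h1]
    rcases h3 with h3 | h3 <;> rw [h3] <;> norm_num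
  obtain ⟨m, hm⟩ := key x
  obtain ⟨m', hm'⟩ := key y
  have hσx : σ x = u x := if_pos hx
  have hσy : σ y = - u y := if_neg hy
  have hx1 : x ∉ F₁ := mem_of_mem_connectedComponentIn hy₁
  have hx2 : x ∉ F₂ := mem_of_mem_connectedComponentIn hy₂
  have hy1 : y ∉ F₁ := connectedComponentIn_subset _ _ hy₁
  have hy2 : y ∉ F₂ := connectedComponentIn_subset _ _ hy₂
  rw [hF₁] at hx1 hy1
  rw [hF₂] at hx2 hy2
  have hx0 : 0 < u x := lt_of_le_of_ne (hu0 x) (Ne.symm hx1)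
  have hx1 : u x < 1 := lt_of_le_of_ne (hu1 x) hx2
  have hy0 : 0 < u y := lt_of_le_of_ne (hu0 y) (Ne.symm hy1)
  have hy1 : u y < 1 := lt_of_le_of_ne (hu1 y) hy2
  rw [hσx] at hm
  rw [hσy] at hm'
  -- Here φ x ∈ (2πm, 2πm + π) and φ y ∈ (2πm' - π, 2πm'). The two values lie on opposite sides of
  -- 2πm or of 2πm + π, which φ omits off `F₁` and off `F₂` respectively.
  rcases le_or_gt m' m with h | h
  · have h' : (m' : ℝ) ≤ m := by exact_mod_cast h
    obtain ⟨z, hz, hz'⟩ := isPreconnected_connectedComponentIn.intermediate_value hy₁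
      (mem_connectedComponentIn (mem_of_mem_connectedComponentIn hy₁)) φ.continuous.continuousOn
      (show 2 * Real.pi * m ∈ Icc (φ y) (φ x) from ⟨by nlinarith, by nlinarith⟩)
    exact no₁ z (connectedComponentIn_subset _ _ hz) m hz'
  · have h' : (m : ℝ) + 1 ≤ m' := by exact_mod_cast h
    obtain ⟨z, hz, hz'⟩ := isPreconnected_connectedComponentIn.intermediate_value
      (mem_connectedComponentIn (mem_of_mem_connectedComponentIn hy₂)) hy₂ φ.continuous.continuousOn
      (show 2 * Real.pi * m + Real.pi ∈ Icc (φ x) (φ y) from ⟨by nlinarith, by nlinarith⟩)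
    exact no₂ z (connectedComponentIn_subset _ _ hz) m hz'

/-- A closed set separating two points contains a closed connected set separating them. -/
theorem CircleLifts.exists_isPreconnected_separating [LocallyPathConnectedSpace X]
    (hX : CircleLifts X) {F : Set X} (hF : IsClosed F) {x y : X} (hxy : y ∉ connectedComponentIn Fᶜ x) :
    ∃ B ⊆ F, IsClosed B ∧ IsPreconnected B ∧ y ∉ connectedComponentIn Bᶜ x := by
  -- A minimal closed separator is wanted. Chains have lower bounds: a path avoiding the
  -- intersection is compact, so it already avoids some member.
  obtain ⟨B, hBF, hB⟩ := zorn_superset_nonempty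
    {B | IsClosed B ∧ B ⊆ F ∧ y ∉ connectedComponentIn Bᶜ x} (fun c hc hchain hcn => by
      refine ⟨⋂₀ c, ⟨isClosed_sInter fun s hs => (hc hs).1, ?_, fun hmem => ?_⟩,
        fun s hs => sInter_subset_of_mem hs⟩
      · obtain ⟨s, hs⟩ := hcn
        exact (sInter_subset_of_mem hs).trans (hc hs).2.1
      · obtain ⟨γ, hγ⟩ := joinedIn_of_mem_connectedComponentIn
          (isClosed_sInter fun s hs => (hc hs).1).isOpen_compl hmem
        have : Nonempty c := hcn.to_subtype
        obtain ⟨⟨s, hs⟩, hsγ⟩ := (isCompact_range γ.continuous).elim_directed_cover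
          (fun s : c => (s : Set X)ᶜ) (fun s => (hc s.2).1.isOpen_compl)
          (by
            rintro _ ⟨t, rfl⟩
            have := hγ t
            simpa using this)
          (by
            intro a b
            rcases hchain.total a.2 b.2 with h | h
            · exact ⟨a, Subset.rfl, compl_subset_compl.2 h⟩
            · exact ⟨b, compl_subset_compl.2 h, Subset.rfl⟩)
        refine (hc hs).2.2 ?_
        have hr : IsPreconnected (range γ) := isPreconnected_range γ.continuous
        exact hr.subset_connectedComponentIn ⟨0, γ.source⟩ hsγ ⟨1, γ.target⟩)
    F ⟨hF, Subset.rfl, hxy⟩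
  refine ⟨B, hBF, hB.prop.1, ?_, hB.prop.2.2⟩
  rw [isPreconnected_iff_subset_of_fully_disjoint_closed hB.prop.1]
  intro u v hu hv huv hd
  by_contra! hcon
  -- By minimality a proper closed part of `B` does not separate; two disjoint such parts would then
  -- have a nonseparating union, namely `B`.
  have aux : ∀ w, IsClosed w → ¬ B ⊆ w → y ∈ connectedComponentIn (B ∩ w)ᶜ x := by
    intro w hw hBw
    by_contra hmem
    exact hBw ((hB.le_of_le ⟨hB.prop.1.inter hw, inter_subset_left.trans hBF, hmem⟩
      inter_subset_left).trans inter_subset_right)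
  have := hX.mem_connectedComponentIn_union (hB.prop.1.inter hu) (hB.prop.1.inter hv)
    (hd.mono inter_subset_right inter_subset_right) (aux u hu hcon.1) (aux v hv hcon.2)
  rw [← inter_union_distrib_left, inter_eq_left.2 huv] at this
  exact hB.prop.2.2 this

end Separation

/-! ### Contours and their upper semicontinuity. -/

section Contours

variable {X : Type*} [TopologicalSpace X] {f : X → ℝ}

/-- The contour of `f` through `x`. -/
def contourAt (f : X → ℝ) (x : X) : Set X := connectedComponentIn (f ⁻¹' {f x}) x

theorem mem_contourAt (f : X → ℝ) (x : X) : x ∈ contourAt f x := mem_connectedComponentIn rfl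

theorem isContour_contourAt (f : X → ℝ) (x : X) : IsContour f (contourAt f x) :=
  ⟨f x, x, rfl, rfl⟩

theorem isPreconnected_contourAt (f : X → ℝ) (x : X) : IsPreconnected (contourAt f x) :=
  isPreconnected_connectedComponentIn

theorem eq_of_mem_contourAt {x y : X} (h : y ∈ contourAt f x) : f y = f x :=
  connectedComponentIn_subset (f ⁻¹' {f x}) x h

theorem isClosed_contourAt (hf : Continuous f) (x : X) : IsClosed (contourAt f x) :=
  isClosed_connectedComponentIn (isClosed_singleton.preimage hf) x

/-- In the compact Hausdorff level set the component is an intersection of clopen sets, so some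
clopen piece `Z` lies in `N`; normality separates `Z` from the rest of the level. -/
theorem exists_isOpen_frontier_avoids_level [CompactSpace X] [T2Space X] (hf : Continuous f)
    {x : X} {N : Set X} (hN : IsOpen N) (hxN : contourAt f x ⊆ N) :
    ∃ O, IsOpen O ∧ contourAt f x ⊆ O ∧ O ⊆ N ∧ ∀ z ∈ frontier O, f z ≠ f x := by
  have hL : IsClosed (f ⁻¹' {f x}) := isClosed_singleton.preimage hf
  have hxL : x ∈ f ⁻¹' {f x} := rfl
  have : CompactSpace (f ⁻¹' {f x}) := isCompact_iff_compactSpace.1 hL.isCompact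
  have hC : contourAt f x = Subtype.val '' connectedComponent (⟨x, hxL⟩ : f ⁻¹' {f x}) :=
    connectedComponentIn_eq_image hxL
  have : Nonempty {s : Set (f ⁻¹' {f x}) // IsClopen s ∧ (⟨x, hxL⟩ : f ⁻¹' {f x}) ∈ s} :=
    ⟨⟨univ, isClopen_univ, mem_univ _⟩⟩
  obtain ⟨⟨Z, hZ, hxZ⟩, hZN⟩ := exists_subset_nhds_of_compactSpace
    (V := fun s : {s : Set (f ⁻¹' {f x}) // IsClopen s ∧ (⟨x, hxL⟩ : f ⁻¹' {f x}) ∈ s} =>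
      (s : Set (f ⁻¹' {f x})))
    (U := Subtype.val ⁻¹' N)
    (fun a b => ⟨⟨a ∩ b, a.2.1.inter b.2.1, a.2.2, b.2.2⟩, inter_subset_left, inter_subset_right⟩)
    (fun s => s.2.1.1)
    (fun z hz => (hN.preimage continuous_subtype_val).mem_nhds <| by
      rw [← connectedComponent_eq_iInter_isClopen] at hz
      exact hxN (hC ▸ mem_image_of_mem _ hz))
  have hA : IsClosed (Subtype.val '' Z : Set X) := hL.isClosedMap_subtype_val Z hZ.1
  have hB : IsClosed (Subtype.val '' Zᶜ : Set X) := hL.isClosedMap_subtype_val _ hZ.compl.1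
  obtain ⟨O, hO, hAO, hON⟩ := normal_exists_closure_subset hA (hN.inter hB.isOpen_compl) (by
    rintro _ ⟨z, hz, rfl⟩
    refine ⟨hZN hz, ?_⟩
    rintro ⟨w, hw, hwz⟩
    exact hw (Subtype.ext hwz ▸ hz))
  refine ⟨O, hO, ?_, fun z hz => (hON (subset_closure hz)).1, fun z hz hzx => ?_⟩
  · rw [hC]
    exact (image_mono (hZ.connectedComponent_subset hxZ)).trans hAO
  · by_cases hzZ : (⟨z, hzx⟩ : f ⁻¹' {f x}) ∈ Z
    · exact hz.2 (by rw [hO.interior_eq]; exact hAO ⟨_, hzZ, rfl⟩)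
    · exact (hON hz.1).2 ⟨_, hzZ, rfl⟩

theorem contourAt_subset_of_notMem {O : Set X} (hO : IsOpen O) {y : X} (hy : y ∈ O)
    (h : f y ∉ f '' frontier O) : contourAt f y ⊆ O := by
  refine (isPreconnected_contourAt f y).subset_of_disjoint_frontier hO ⟨y, mem_contourAt f y, hy⟩
    (disjoint_left.2 fun z hz hz' => h ⟨z, hz', eq_of_mem_contourAt hz⟩)

/-- Contours depend upper semicontinuously on the base point. -/
theorem eventually_contourAt_subset [CompactSpace X] [T2Space X] (hf : Continuous f)
    {x : X} {N : Set X} (hN : IsOpen N) (hxN : contourAt f x ⊆ N) :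
    ∀ᶠ y in 𝓝 x, contourAt f y ⊆ N := by
  obtain ⟨O, hO, hxO, hON, hfr⟩ := exists_isOpen_frontier_avoids_level hf hN hxN
  have hW : IsClosed (f '' frontier O) := (isClosed_frontier.isCompact.image hf).isClosed
  filter_upwards [hO.mem_nhds (hxO (mem_contourAt f x)),
    (hW.isOpen_compl.preimage hf).mem_nhds (fun ⟨z, hz, h⟩ => hfr z hz h)] with y hy hy'
  exact (contourAt_subset_of_notMem hO hy hy').trans hON

end Contours

/-! ### Separating contours and the minimality argument. -/

variable {X : Type*} [MetricSpace X]

/-- Arbitrarily close to a contour there are contours separating it from a given point. -/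
theorem CircleLifts.exists_contourAt_separating [CompactSpace X] [LocallyPathConnectedSpace X]
    [PreconnectedSpace X] (hX : CircleLifts X) {f : X → ℝ} (hf : Continuous f)
    {x k : X} {N : Set X} (hN : IsOpen N) (hxN : contourAt f x ⊆ N) (hk : k ∉ N) :
    ∃ y, contourAt f y ⊆ N ∧ x ∉ contourAt f y ∧ k ∉ connectedComponentIn (contourAt f y)ᶜ x := by
  obtain ⟨O, hO, hxO, hON, hfr⟩ := exists_isOpen_frontier_avoids_level hf hN hxN
  have hW : IsClosed (f '' frontier O) := (isClosed_frontier.isCompact.image hf).isClosed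
  obtain ⟨δ, hδ, hball⟩ := Metric.isOpen_iff.1 hW.isOpen_compl (f x)
    (fun ⟨z, hz, h⟩ => hfr z hz h)
  have hfrO : ∀ z ∈ closure O, |f z - f x| < δ → z ∈ O := fun z hz hzδ => by
    by_contra hzO
    exact hball (show f z ∈ Metric.ball (f x) δ by simpa [Real.dist_eq] using hzδ)
      ⟨z, ⟨hz, by rwa [hO.interior_eq]⟩, rfl⟩
  have hc : Continuous fun z => |f z - f x| := by fun_prop
  -- Leaving `O` from `x` requires crossing one of the levels f x ± δ/2 first, since f stays at
  -- distance at least δ from f x on the frontier of `O`.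
  set B : Set X := closure O ∩ {z | |f z - f x| = δ / 2} with hBdef
  have hB : IsClosed B := isClosed_closure.inter (isClosed_eq hc continuous_const)
  have hxB : x ∉ B := fun h => by
    have := h.2
    simp only [mem_ofPred_eq, sub_self, abs_zero] at this
    linarith
  have hsep : connectedComponentIn Bᶜ x ⊆ O := by
    have hG : IsOpen (O ∩ {z | |f z - f x| < δ / 2}) := hO.inter (isOpen_lt hc continuous_const)
    have : connectedComponentIn Bᶜ x ⊆ O ∩ {z | |f z - f x| < δ / 2} := by
      refine isPreconnected_connectedComponentIn.subset_of_closure_inter_subset hG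
        ⟨x, mem_connectedComponentIn hxB, hxO (mem_contourAt f x), by simpa using hδ⟩ ?_
      rintro z ⟨hz, hz'⟩
      have h1 : z ∈ closure O := closure_mono inter_subset_left hz
      have h2 : |f z - f x| ≤ δ / 2 :=
        closure_minimal (fun w hw => le_of_lt hw.2) (isClosed_le hc continuous_const) hz
      have h3 : |f z - f x| ≠ δ / 2 := fun h => connectedComponentIn_subset _ _ hz' ⟨h1, h⟩
      exact ⟨hfrO z h1 (by linarith), lt_of_le_of_ne h2 h3⟩
    exact this.trans inter_subset_left
  obtain ⟨B₀, hB₀B, -, hB₀, hB₀k⟩ := hX.exists_isPreconnected_separating hB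
    (fun h => hk (hON (hsep h)))
  have hne : B₀.Nonempty := by
    rw [nonempty_iff_ne_empty]
    rintro rfl
    rw [compl_empty, connectedComponentIn_univ, PreconnectedSpace.connectedComponent_eq_univ] at hB₀k
    exact hB₀k (mem_univ k)
  obtain ⟨y, hy⟩ := hne
  -- On the connected set `B₀` the function only takes the values f x ± δ/2 and skips f x between
  -- them, so it is constant and `B₀` lies in a single contour.
  have aux : ∀ a ∈ B₀, ∀ b ∈ B₀, ¬ f a < f b := by
    intro a ha b hb hab
    have h1 : |f a - f x| = δ / 2 := (hB₀B ha).2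
    have h2 : |f b - f x| = δ / 2 := (hB₀B hb).2
    obtain ⟨z, hz, hz'⟩ := hB₀.intermediate_value ha hb hf.continuousOn
      (show f x ∈ Icc (f a) (f b) by
        rcases abs_eq (by linarith) |>.1 h1 with h | h <;>
        rcases abs_eq (by linarith) |>.1 h2 with h' | h' <;> constructor <;> linarith)
    have h3 : |f z - f x| = δ / 2 := (hB₀B hz).2
    rw [hz'] at h3
    simp at h3
    linarith
  have hB₀y : B₀ ⊆ contourAt f y := hB₀.subset_connectedComponentIn hy fun z hz =>
    le_antisymm (not_lt.1 (aux y hy z hz)) (not_lt.1 (aux z hz y hy))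
  have hyB : |f y - f x| = δ / 2 := (hB₀B hy).2
  refine ⟨y, ?_, fun hmem => ?_, fun h => hB₀k (connectedComponentIn_mono x
    (compl_subset_compl.2 hB₀y) h)⟩
  · refine (contourAt_subset_of_notMem hO (hfrO y (hB₀B hy).1 (by linarith)) ?_).trans hON
    exact hball (by rw [Metric.mem_ball, Real.dist_eq]; linarith)
  · rw [← eq_of_mem_contourAt hmem] at hyB
    simp at hyB
    linarith

/-- Let `R` be a closed relation on a compact space with trivial first cohomology, and suppose that
for each closed set `G` free of `R`-pairs, the points `z` with `P G z` lie in one component of the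
complement of `G`, compatibly with inclusions. Then some contour contains an `R`-pair. -/
theorem CircleLifts.exists_contourAt_rel [CompactSpace X] [LocallyPathConnectedSpace X]
    [ConnectedSpace X] (hX : CircleLifts X) {f : X → ℝ} (hf : Continuous f)
    {R : Set (X × X)} (hR : IsClosed R) (P : Set X → X → Prop)
    (hP : ∀ G, IsClosed G → Disjoint (G ×ˢ G) R → ∃ z, P G z)
    (hPmono : ∀ G G', IsClosed G → IsClosed G' → Disjoint (G' ×ˢ G') R → G ⊆ G' → ∀ z z',
      P G z → P G' z' → z' ∈ connectedComponentIn Gᶜ z) :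
    ∃ x, ¬ Disjoint (contourAt f x ×ˢ contourAt f x) R := by
  obtain ⟨β, hβ, hmono⟩ : ∃ β : Set X → Set X,
      (∀ G, IsClosed G → Disjoint (G ×ˢ G) R → ∃ z ∉ G, β G = connectedComponentIn Gᶜ z) ∧
      ∀ G G', IsClosed G → IsClosed G' → Disjoint (G' ×ˢ G') R → G ⊆ G' → β G' ⊆ β G := by
    choose! z hz using hP
    refine ⟨fun G => connectedComponentIn Gᶜ (z G), fun G hG hGR => ⟨z G, ?_, rfl⟩,
      fun G G' hG hG' hGR hGG' => ?_⟩
    · exact connectedComponentIn_subset _ _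
        (hPmono G G hG hG hGR Subset.rfl _ _ (hz G hG hGR) (hz G hG hGR))
    · have hGR' : Disjoint (G ×ˢ G) R := hGR.mono_left (prod_mono hGG' hGG')
      have := hPmono G G' hG hG' hGR hGG' _ _ (hz G hG hGR') (hz G' hG' hGR)
      beta_reduce
      rw [connectedComponentIn_eq this]
      exact connectedComponentIn_mono _ (compl_subset_compl.2 hGG')
  by_contra! hdis
  have hcl := isClosed_contourAt hf
  have hD : ∀ x, Disjoint (β (contourAt f x)) (contourAt f x) := fun x => by
    obtain ⟨z, -, hz⟩ := hβ _ (hcl x) (hdis x)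
    rw [hz]
    exact disjoint_compl_left_iff_subset.2 Subset.rfl |>.mono_left (connectedComponentIn_subset _ _)
  have hpre : ∀ x, IsPreconnected (β (contourAt f x)) := fun x => by
    obtain ⟨z, -, hz⟩ := hβ _ (hcl x) (hdis x)
    rw [hz]
    exact isPreconnected_connectedComponentIn
  have hmax : ∀ x, ∀ S, IsPreconnected S → Disjoint S (contourAt f x) →
      (S ∩ β (contourAt f x)).Nonempty → S ⊆ β (contourAt f x) := fun x S hS hd ⟨y, hy, hy'⟩ => by
    obtain ⟨z, -, hz⟩ := hβ _ (hcl x) (hdis x)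
    rw [hz] at hy' ⊢
    exact subset_connectedComponentIn_of_mem hS (disjoint_left.1 hd) hy hy'
  have hopen : ∀ x, IsOpen (β (contourAt f x)) := fun x => by
    obtain ⟨z, -, hz⟩ := hβ _ (hcl x) (hdis x)
    rw [hz]
    exact (hcl x).isOpen_compl.connectedComponentIn
  have hfront : ∀ x, closure (β (contourAt f x)) ∩ (contourAt f x)ᶜ ⊆ β (contourAt f x) :=
    fun x => by
    obtain ⟨z, -, hz⟩ := hβ _ (hcl x) (hdis x)
    rw [hz]
    exact closure_connectedComponentIn_inter_subset (hcl x).isOpen_compl z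
  -- The tube lemma gives a closed neighbourhood `N` still free of `R`-pairs; by monotonicity a
  -- point of β N lies in β of every contour inside `N`.
  have hnhd : ∀ x, ∃ N, IsClosed N ∧ contourAt f x ⊆ interior N ∧ ∃ k ∉ N, ∀ y,
      contourAt f y ⊆ N → k ∈ β (contourAt f y) := by
    intro x
    obtain ⟨U, V, hU, hV, hxU, hxV, hUV⟩ := generalized_tube_lemma (hcl x).isCompact
      (hcl x).isCompact hR.isOpen_compl (disjoint_left.1 (hdis x))
    obtain ⟨O, hO, hxO, hOUV⟩ := normal_exists_closure_subset (hcl x) (hU.inter hV)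
      (subset_inter hxU hxV)
    have hgood : Disjoint (closure O ×ˢ closure O) R := by
      rw [disjoint_left]
      exact fun p hp => hUV ⟨(hOUV hp.1).1, (hOUV hp.2).2⟩
    obtain ⟨k, hk, hk'⟩ := hβ _ isClosed_closure hgood
    refine ⟨closure O, isClosed_closure, hxO.trans (interior_maximal subset_closure hO), k, hk,
      fun y hy => hmono _ _ (hcl y) isClosed_closure hgood hy ?_⟩
    rw [hk']
    exact mem_connectedComponentIn hk
  -- a minimal value of β on contours
  obtain ⟨x₀, hx₀⟩ : ∃ x₀, ∀ y, β (contourAt f y) ⊆ β (contourAt f x₀) →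
      β (contourAt f x₀) ⊆ β (contourAt f y) := by
    obtain ⟨D, -, hDmin⟩ := zorn_superset_nonempty (range fun x => β (contourAt f x))
      (fun c hc hchain hcn => by
        have hcn' : Nonempty c := hcn.to_subtype
        -- Base points of chain members below `s`. A point `x` common to all the closures supplies
        -- the lower bound of the chain.
        let A : c → Set X := fun s => closure {x | β (contourAt f x) ∈ c ∧ β (contourAt f x) ⊆ s}
        obtain ⟨x, hx⟩ := IsCompact.nonempty_iInter_of_directed_nonempty_isCompact_isClosed A
          (by
            have hA : ∀ a b : c, (a : Set X) ⊆ b → A a ⊆ A b := fun a b h =>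
              closure_mono fun x hx => ⟨hx.1, hx.2.trans h⟩
            intro a b
            rcases hchain.total a.2 b.2 with h | h
            · exact ⟨a, Subset.rfl, hA a b h⟩
            · exact ⟨b, hA b a h, Subset.rfl⟩)
          (fun s => by
            obtain ⟨x, hx⟩ := hc s.2
            exact ⟨x, subset_closure ⟨by rw [show β (contourAt f x) = s from hx]; exact s.2,
              hx.subset⟩⟩)
          (fun _ => isClosed_closure.isCompact) (fun _ => isClosed_closure)
        have hnear : ∀ N, IsOpen N → contourAt f x ⊆ N → ∀ s ∈ c, ∃ y, contourAt f y ⊆ N ∧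
            β (contourAt f y) ⊆ s := by
          intro N hN hxN s hs
          obtain ⟨y, hy, hy'⟩ := mem_closure_iff_nhds.1 (mem_iInter.1 hx ⟨s, hs⟩) _
            (eventually_contourAt_subset hf hN hxN)
          exact ⟨y, hy, hy'.2⟩
        refine ⟨_, ⟨x, rfl⟩, fun s hs => ?_⟩
        obtain ⟨N, hN, hxN, k, hkN, hk⟩ := hnhd x
        have hks : ∀ s ∈ c, k ∈ s := fun s hs => by
          obtain ⟨y, hy, hys⟩ := hnear _ isOpen_interior hxN s hs
          exact hys (hk y (hy.trans interior_subset))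
        have hkx : k ∈ β (contourAt f x) := hk x (hxN.trans interior_subset)
        obtain ⟨z, rfl⟩ := hc hs
        refine hmax z _ (hpre x) (disjoint_left.2 fun p hp hpz => ?_) ⟨k, hkx, hks _ hs⟩
        obtain ⟨w, -, hw⟩ := hβ _ (hcl x) (hdis x)
        -- Join `p` to `k` inside β of the contour at `x`. Contours close enough to it avoid this
        -- compact path, so their β contains the path; one of them has β inside that of the contour
        -- at `z`, which excludes `p`.
        have hpk : k ∈ connectedComponentIn (β (contourAt f x)) p :=
          (hpre x).subset_connectedComponentIn hp Subset.rfl hkx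
        obtain ⟨γ, hγ⟩ := joinedIn_of_mem_connectedComponentIn (hopen x) hpk
        obtain ⟨y, hy, hys⟩ := hnear (interior N ∩ (range γ)ᶜ)
          (isOpen_interior.inter (isCompact_range γ.continuous).isClosed.isOpen_compl)
          (subset_inter hxN fun q hq => by
            rintro ⟨t, rfl⟩
            exact disjoint_left.1 (hD x) (hγ t) hq) _ hs
        have hky : k ∈ β (contourAt f y) :=
          hk y (hy.trans (inter_subset_left.trans interior_subset))
        have : range γ ⊆ β (contourAt f y) := hmax y _ (isPreconnected_range γ.continuous)
          (disjoint_right.2 fun q hq => (hy hq).2) ⟨k, ⟨1, γ.target⟩, hky⟩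
        exact disjoint_left.1 (hD z) (hys (this ⟨0, γ.source⟩)) hpz)
      _ ⟨Classical.arbitrary X, rfl⟩
    obtain ⟨x₀, rfl⟩ := hDmin.prop
    exact ⟨x₀, fun y hy => hDmin.le_of_le ⟨y, rfl⟩ hy⟩
  obtain ⟨N, hN, hxN, k, hkN, hk⟩ := hnhd x₀
  obtain ⟨y, hyN, hxy, hky⟩ := hX.exists_contourAt_separating hf isOpen_interior hxN
    (fun h => hkN (interior_subset h))
  have hk₀ := hk x₀ (hxN.trans interior_subset)
  have hk₁ := hk y (hyN.trans interior_subset)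
  have hdisj : Disjoint (contourAt f x₀) (contourAt f y) := disjoint_left.2 fun z hz hz' => hxy (by
    have e1 := eq_of_mem_contourAt hz
    have e2 := eq_of_mem_contourAt hz'
    exact subset_connectedComponentIn_of_mem (isPreconnected_contourAt f x₀)
      (fun w hw => ((eq_of_mem_contourAt hw).trans e1.symm).trans e2) hz hz' (mem_contourAt f x₀))
  -- Otherwise β of the contour at `y` would contain both `x₀` and `k`, which that contour
  -- separates.
  have hsub : Disjoint (β (contourAt f y)) (contourAt f x₀) := by
    rw [disjoint_right]
    intro z hz hz'
    have hx₀y : x₀ ∈ β (contourAt f y) := hmax y _ (isPreconnected_contourAt f x₀) hdisj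
      ⟨z, hz, hz'⟩ (mem_contourAt f x₀)
    exact hky ((hpre y).subset_connectedComponentIn hx₀y (disjoint_left.1 (hD y)) hk₁)
  have hle : β (contourAt f y) ⊆ β (contourAt f x₀) := hmax x₀ _ (hpre y) hsub ⟨k, hk₁, hk₀⟩
  have heq : β (contourAt f y) = β (contourAt f x₀) := hle.antisymm (hx₀ y hle)
  -- A frontier point of this common value of β would lie on both of two disjoint contours.
  have hclopen : IsClopen (β (contourAt f x₀)) := by
    refine ⟨isClosed_of_closure_subset fun z hz => ?_, hopen x₀⟩
    by_cases hzx : z ∈ contourAt f x₀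
    · rw [← heq] at hz ⊢
      exact hfront y ⟨hz, disjoint_left.1 hdisj hzx⟩
    · exact hfront x₀ ⟨hz, hzx⟩
  have huniv := hclopen.eq_univ ⟨k, hk₀⟩
  exact disjoint_left.1 (hD x₀) (huniv ▸ mem_univ x₀) (mem_contourAt f x₀)

/-! ### Borsuk–Ulam and antipodally symmetric components. -/

section Antipodal

variable {X : Type*}

/-- If `h` had no zero, lift h/‖h‖ to φ. Then φ(-x) - φ(x) is odd, and it never vanishes because
antipodal points have opposite images on the circle; this contradicts the intermediate value
theorem. -/
theorem CircleLifts.exists_eq_zero_of_odd [TopologicalSpace X] [ConnectedSpace X]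
    [InvolutiveNeg X] [ContinuousNeg X] (hX : CircleLifts X) {h : X → ℂ} (hc : Continuous h)
    (hodd : ∀ x, h (-x) = - h x) : ∃ x, h x = 0 := by
  by_contra! hne
  let θ : X → Circle := fun x => ⟨h x / ‖h x‖, mem_sphere_zero_iff_norm.2 (by simp [hne x])⟩
  have hθ : Continuous θ := by
    refine Continuous.subtype_mk (hc.div (by fun_prop) fun x => ?_) _
    simpa using hne x
  obtain ⟨φ, hφ⟩ := hX ⟨θ, hθ⟩
  have hanti : ∀ x, θ (-x) = - θ x := fun x => by
    have hcoe : ∀ x, (θ x : ℂ) = h x / ‖h x‖ := fun _ => rfl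
    apply Circle.ext
    rw [Circle.coe_neg, hcoe, hcoe, hodd, norm_neg, neg_div]
  have hd : ∀ x, φ (-x) - φ x ≠ 0 := fun x h0 => by
    have h1 : θ (-x) = θ x := by
      have e1 := hφ (-x)
      have e2 := hφ x
      simp only [ContinuousMap.coe_mk] at e1 e2
      rw [e1, e2, sub_eq_zero.1 h0]
    exact Circle.neg_ne_self _ ((hanti x).symm.trans h1)
  have hdc : Continuous fun x => φ (-x) - φ x := by fun_prop
  obtain ⟨x⟩ := (inferInstance : Nonempty X)
  rcases lt_or_gt_of_ne (hd x) with hx | hx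
  · obtain ⟨z, hz⟩ := mem_range_of_exists_le_of_exists_ge hdc (c := 0) ⟨x, hx.le⟩
      ⟨-x, by simp only [neg_neg]; linarith⟩
    exact hd z hz
  · obtain ⟨z, hz⟩ := mem_range_of_exists_le_of_exists_ge hdc (c := 0)
      ⟨-x, by simp only [neg_neg]; linarith⟩ ⟨x, hx.le⟩
    exact hd z hz

theorem neg_mem_connectedComponentIn [TopologicalSpace X] [InvolutiveNeg X] [ContinuousNeg X]
    {F : Set X} (hF : ∀ x ∈ F, -x ∈ F) {x y : X} (h : y ∈ connectedComponentIn F x) :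
    -y ∈ connectedComponentIn F (-x) := by
  have hx := mem_of_mem_connectedComponentIn h
  have hpre : IsPreconnected (Neg.neg '' connectedComponentIn F x) :=
    isPreconnected_connectedComponentIn.image _ continuous_neg.continuousOn
  refine hpre.subset_connectedComponentIn (mem_image_of_mem _ (mem_connectedComponentIn hx)) ?_
    (mem_image_of_mem _ h)
  rintro _ ⟨z, hz, rfl⟩
  exact hF z (connectedComponentIn_subset _ _ hz)

open Metric in
/-- The complement of a closed set `G ∪ -G` with `G ∩ -G = ∅` has an antipodally symmetric
component. -/
theorem CircleLifts.exists_neg_mem_connectedComponentIn [MetricSpace X] [ConnectedSpace X]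
    [LocallyConnectedSpace X] [InvolutiveNeg X] [ContinuousNeg X] (hX : CircleLifts X)
    {G : Set X} (hG : IsClosed G) (hGn : ∀ x ∈ G, -x ∉ G) :
    ∃ x, -x ∈ connectedComponentIn (G ∪ -G)ᶜ x := by
  classical
  rcases G.eq_empty_or_nonempty with rfl | hne
  · obtain ⟨x⟩ := (inferInstance : Nonempty X)
    refine ⟨x, ?_⟩
    simp [connectedComponentIn_univ, PreconnectedSpace.connectedComponent_eq_univ]
  by_contra! hno
  set F := G ∪ -G with hFdef
  have hF : IsClosed F := hG.union (hG.preimage continuous_neg)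
  have hFne : F.Nonempty := hne.mono subset_union_left
  have hFn : ∀ x, -x ∈ F ↔ x ∈ F := fun x => by
    simp only [hFdef, mem_union, Set.mem_neg, neg_neg]; exact or_comm
  let C : X → Set X := fun x => connectedComponentIn Fᶜ x
  -- With no symmetric component, the components come in pairs swapped by negation; the well-order
  -- selects one of each pair.
  let W : Set X := {x | x ∉ F ∧ WellOrderingRel (C x) (C (-x))}
  have hCne : ∀ x ∉ F, C x ≠ C (-x) := fun x hx h => by
    apply hno x
    change -x ∈ C x
    rw [h]
    exact mem_connectedComponentIn (by rwa [mem_compl_iff, hFn])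
  have hFnc : ∀ x ∈ Fᶜ, -x ∈ Fᶜ := fun x hx h => hx ((hFn x).1 h)
  have hW : ∀ z ∈ W, ∀ y ∈ C z, y ∈ W := by
    intro z hz y hy
    refine ⟨connectedComponentIn_subset _ _ hy, ?_⟩
    have h1 : C z = C y := connectedComponentIn_eq hy
    have h2 : C (-z) = C (-y) := connectedComponentIn_eq (neg_mem_connectedComponentIn hFnc hy)
    rw [← h1, ← h2]
    exact hz.2
  have hWo : IsOpen W := isOpen_iff_mem_nhds.2 fun z hz =>
    mem_of_superset (hF.isOpen_compl.connectedComponentIn.mem_nhds (mem_connectedComponentIn hz.1))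
      (hW z hz)
  have hWc : ∀ z ∈ closure W, z ∉ F → z ∈ W := by
    intro z hz hzF
    obtain ⟨w, hw, hwW⟩ := mem_closure_iff.1 hz _ hF.isOpen_compl.connectedComponentIn
      (mem_connectedComponentIn hzF)
    exact hW w hwW z (mem_connectedComponentIn_symm hw)
  have hWn : ∀ z ∉ F, (-z ∈ W ↔ z ∉ W) := by
    intro z hz
    have hz' : -z ∉ F := by rwa [hFn]
    simp only [W, mem_ofPred_eq, hz, hz', not_false_eq_true, true_and, neg_neg]
    rcases trichotomous_of WellOrderingRel (C z) (C (-z)) with h | h | h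
    · exact ⟨fun h' => absurd h (asymm h'), fun h' => absurd h h'⟩
    · exact absurd h (hCne z hz)
    · exact ⟨fun h' => asymm h', fun _ => h⟩
  -- The odd map a + ic must vanish somewhere. But c = ±b vanishes only on `F = G ∪ -G`, and there a
  -- = 0 would put the point in both G and -G.
  let a : X → ℝ := fun x => infDist (-x) G - infDist x G
  let b : X → ℝ := fun x => infDist x F + infDist (-x) F
  have ha : Continuous a := ((continuous_infDist_pt G).comp continuous_neg).sub
    (continuous_infDist_pt G)
  have hb : Continuous b := (continuous_infDist_pt F).add
    ((continuous_infDist_pt F).comp continuous_neg)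
  have hb0 : ∀ x, b x = 0 ↔ x ∈ F := fun x => by
    constructor
    · intro h
      have h1 := infDist_nonneg (x := x) (s := F)
      have h2 := infDist_nonneg (x := -x) (s := F)
      have h3 : infDist x F + infDist (-x) F = 0 := h
      exact (hF.mem_iff_infDist_zero hFne).2 (by linarith)
    · intro h
      simp only [b]
      rw [(hF.mem_iff_infDist_zero hFne).1 h, (hF.mem_iff_infDist_zero hFne).1 ((hFn x).2 h),
        add_zero]
  let c : X → ℝ := fun x => if x ∈ W then b x else - b x
  have hc : Continuous c := by
    refine Continuous.if (fun x hx => ?_) hb hb.neg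
    have hxF : x ∈ F := by
      by_contra hxF
      apply hx.2
      rw [show {x | x ∈ W} = W from rfl, hWo.interior_eq]
      exact hWc x hx.1 hxF
    rw [(hb0 x).2 hxF, neg_zero]
  have hcodd : ∀ x, c (-x) = - c x := fun x => by
    have hbn : b (-x) = b x := by simp only [b, neg_neg]; ring
    by_cases hx : x ∈ F
    · have : b x = 0 := (hb0 x).2 hx
      simp [c, hbn, this]
    · by_cases hxW : x ∈ W
      · simp [c, hbn, hWn x hx, hxW]
      · simp [c, hbn, hWn x hx, hxW]
  obtain ⟨x, hx⟩ := hX.exists_eq_zero_of_odd (h := fun x => (a x : ℂ) + c x * Complex.I)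
    (by fun_prop) (fun x => by
      have : a (-x) = - a x := by simp only [a, neg_neg]; ring
      simp only [this, hcodd]; push_cast; ring)
  have hax : a x = 0 := by simpa using congrArg Complex.re hx
  have hcx : c x = 0 := by simpa using congrArg Complex.im hx
  have hbx : b x = 0 := by
    simp only [c] at hcx
    split_ifs at hcx
    · exact hcx
    · linarith
  have hax' : infDist (-x) G = infDist x G := sub_eq_zero.1 hax
  rcases (hb0 x).1 hbx with h | h
  · have h0 := (hG.mem_iff_infDist_zero hne).1 h
    exact hGn x h ((hG.mem_iff_infDist_zero hne).2 (hax'.trans h0))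
  · have h0 := (hG.mem_iff_infDist_zero hne).1 h
    have := (hG.mem_iff_infDist_zero hne).2 (hax'.symm.trans h0)
    exact hGn x this h

/-- If `F ∩ -F = ∅`, then the antipodally symmetric components of the complement of `F ∪ -F` lie in
one component of the complement of `F`. -/
theorem CircleLifts.mem_connectedComponentIn_of_neg_mem [MetricSpace X] [ConnectedSpace X]
    [LocallyPathConnectedSpace X] [InvolutiveNeg X] [ContinuousNeg X] (hX : CircleLifts X)
    {F : Set X} (hF : IsClosed F) (hFn : ∀ x ∈ F, -x ∉ F) {x y : X}
    (hx : -x ∈ connectedComponentIn (F ∪ -F)ᶜ x) (hy : -y ∈ connectedComponentIn (F ∪ -F)ᶜ y) :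
    y ∈ connectedComponentIn Fᶜ x := by
  by_contra hxy
  obtain ⟨B, hBF, hBc, hB, hBxy⟩ := hX.exists_isPreconnected_separating hF hxy
  have hne : B.Nonempty := by
    rw [nonempty_iff_ne_empty]
    rintro rfl
    rw [compl_empty, connectedComponentIn_univ, PreconnectedSpace.connectedComponent_eq_univ] at hBxy
    exact hBxy (mem_univ _)
  -- The component `O` of `z` off `B` must contain -B. Otherwise -B misses `O`, so `O` is stable
  -- under negation and its frontier lies in both B and -B, hence is empty; then `O` is everything,
  -- including `w`. Applied to `x` and `y`, this puts -B in two different components.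
  have key : ∀ z w, -z ∈ connectedComponentIn (F ∪ -F)ᶜ z → w ∉ connectedComponentIn Bᶜ z →
      Neg.neg '' B ⊆ connectedComponentIn Bᶜ z := by
    intro z w hz hw
    set O := connectedComponentIn Bᶜ z with hO
    have hBo : IsOpen Bᶜ := hBc.isOpen_compl
    have hzO : -z ∈ O := connectedComponentIn_mono z
      (compl_subset_compl.2 (hBF.trans subset_union_left)) hz
    have hz0 : z ∈ O := mem_connectedComponentIn (mem_of_mem_connectedComponentIn hzO)
    have hnB : Neg.neg '' B ⊆ Bᶜ := by
      rintro _ ⟨b, hb, rfl⟩ hb'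
      exact hFn b (hBF hb) (hBF hb')
    by_cases hmeet : ∃ b ∈ B, -b ∈ O
    · obtain ⟨b, hb, hbO⟩ := hmeet
      exact subset_connectedComponentIn_of_mem (hB.image _ continuous_neg.continuousOn) hnB
        (mem_image_of_mem _ hb) hbO
    · push Not at hmeet
      have hOn : ∀ p ∈ O, -p ∈ O := by
        have : Neg.neg '' O ⊆ O := subset_connectedComponentIn_of_mem
          (isPreconnected_connectedComponentIn.image _ continuous_neg.continuousOn)
          (by
            rintro _ ⟨p, hp, rfl⟩ hpB
            exact hmeet _ hpB (by rwa [neg_neg]))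
          (mem_image_of_mem _ hz0) hzO
        exact fun p hp => this (mem_image_of_mem _ hp)
      have hcl : ∀ p ∈ closure O, p ∉ O → p ∈ B := fun p hp hpO => by
        by_contra hpB
        exact hpO (closure_connectedComponentIn_inter_subset hBo z ⟨hp, hpB⟩)
      have hclosed : IsClosed O := isClosed_of_closure_subset fun p hp => by
        by_contra hpO
        have hnp : -p ∈ closure O := map_mem_closure continuous_neg hp hOn
        have hnpO : -p ∉ O := fun h => hpO (by simpa using hOn _ h)
        exact hFn p (hBF (hcl p hp hpO)) (hBF (hcl _ hnp hnpO))
      exact absurd ((IsClopen.eq_univ ⟨hclosed, hBo.connectedComponentIn⟩ ⟨z, hz0⟩) ▸ mem_univ w) hw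
  obtain ⟨b, hb⟩ := hne
  have h1 := key x y hx hBxy (mem_image_of_mem _ hb)
  have h2 := key y x hy (fun h => hBxy (mem_connectedComponentIn_symm h)) (mem_image_of_mem _ hb)
  apply hBxy
  rw [connectedComponentIn_eq h1]
  exact mem_connectedComponentIn_symm h2

end Antipodal

/-! ### Circle lifts on balls and on spheres. -/

section Lifts

theorem circleLifts_of_simplyConnected (Y : Type*) [TopologicalSpace Y] [SimplyConnectedSpace Y]
    [LocallyPathConnectedSpace Y] : CircleLifts Y := by
  intro θ
  obtain ⟨y⟩ := (inferInstance : Nonempty Y)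
  obtain ⟨t, ht⟩ : ∃ t, Circle.exp t = θ y := ⟨_, Circle.exp_arg _⟩
  obtain ⟨φ, ⟨-, hφ⟩, -⟩ := Circle.isCoveringMap_exp.existsUnique_continuousMap_lifts θ y t ht
  exact ⟨φ, fun x => (congrFun hφ x).symm⟩

theorem CircleLifts.of_retract {X Y : Type*} [TopologicalSpace X] [TopologicalSpace Y]
    (hY : CircleLifts Y) {i : X → Y} {r : Y → X} (hi : Continuous i) (hr : Continuous r)
    (h : ∀ x, r (i x) = x) : CircleLifts X := by
  intro θ
  obtain ⟨φ, hφ⟩ := hY (θ.comp ⟨r, hr⟩)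
  exact ⟨φ.comp ⟨i, hi⟩, fun x => by simpa [h] using hφ (i x)⟩

theorem locallyPathConnectedSpace_of_retract {X Y : Type*} [TopologicalSpace X]
    [TopologicalSpace Y] [LocallyPathConnectedSpace Y] {i : X → Y} {r : Y → X} (hi : Continuous i)
    (hr : Continuous r) (h : ∀ x, r (i x) = x) : LocallyPathConnectedSpace X :=
  (IsQuotientMap.of_inverse hi hr h).locallyPathConnectedSpace

theorem eq_of_isPreconnected_of_int_valued {X : Type*} [TopologicalSpace X] {S : Set X}
    (hS : IsPreconnected S) {g : X → ℝ} (hg : ContinuousOn g S) (hint : ∀ x ∈ S, ∃ m : ℤ, g x = m)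
    {x y : X} (hx : x ∈ S) (hy : y ∈ S) : g x = g y := by
  have key : ∀ a ∈ S, ∀ b ∈ S, ¬ g a < g b := by
    intro a ha b hb hab
    obtain ⟨m, hm⟩ := hint a ha
    obtain ⟨k, hk⟩ := hint b hb
    rw [hm, hk] at hab
    have hmk : m + 1 ≤ k := by exact_mod_cast hab
    have hmk' : (m : ℝ) + 1 ≤ k := by exact_mod_cast hmk
    obtain ⟨z, hz, hz'⟩ := hS.intermediate_value ha hb hg
      (show (m : ℝ) + 1 / 2 ∈ Icc (g a) (g b) from ⟨by linarith, by linarith⟩)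
    obtain ⟨l, hl⟩ := hint z hz
    have h1 : (2 * l : ℝ) = 2 * m + 1 := by linarith
    norm_cast at h1
    omega
  exact le_antisymm (not_lt.1 (key y hy x hx)) (not_lt.1 (key x hx y hy))

variable {V : Type*} [NormedAddCommGroup V]

theorem sphere_subset_compl_zero : Metric.sphere (0 : V) 1 ⊆ {0}ᶜ := fun x hx h => by
  rw [mem_singleton_iff] at h
  simp [h] at hx

section Ball

variable [NormedSpace ℝ V]

/-- The radial retraction onto the closed unit ball. -/
noncomputable def ballRetract (v : V) : Metric.closedBall (0 : V) 1 :=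
  ⟨(max 1 ‖v‖)⁻¹ • v, by
    have h : 0 < max 1 ‖v‖ := lt_max_of_lt_left one_pos
    rw [mem_closedBall_zero_iff, norm_smul, norm_inv, Real.norm_of_nonneg h.le,
      inv_mul_le_one₀ h]
    exact le_max_right _ _⟩

theorem continuous_ballRetract : Continuous (ballRetract (V := V)) := by
  refine Continuous.subtype_mk (Continuous.smul (Continuous.inv₀ (by fun_prop) fun v => ?_)
    continuous_id) _
  exact (lt_max_of_lt_left one_pos).ne'

theorem ballRetract_coe (x : Metric.closedBall (0 : V) 1) : ballRetract (x : V) = x := by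
  ext
  simp [ballRetract, max_eq_left (mem_closedBall_zero_iff.1 x.2)]

theorem circleLifts_closedBall : CircleLifts (Metric.closedBall (0 : V) 1) :=
  (circleLifts_of_simplyConnected V).of_retract continuous_subtype_val continuous_ballRetract
    ballRetract_coe

instance : LocallyPathConnectedSpace (Metric.closedBall (0 : V) 1) :=
  locallyPathConnectedSpace_of_retract continuous_subtype_val continuous_ballRetract
    ballRetract_coe

instance : ConnectedSpace (Metric.closedBall (0 : V) 1) :=
  isConnected_iff_connectedSpace.1
    ((convex_closedBall _ _).isConnected ⟨0, by simp⟩)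

/-- The radial projection onto the unit sphere. -/
noncomputable def sphereRetract (v : ({0}ᶜ : Set V)) : Metric.sphere (0 : V) 1 :=
  ⟨‖(v : V)‖⁻¹ • (v : V), by
    have : ‖(v : V)‖ ≠ 0 := norm_ne_zero_iff.2 v.2
    rw [mem_sphere_zero_iff_norm, norm_smul, norm_inv, norm_norm, inv_mul_cancel₀ this]⟩

theorem continuous_sphereRetract : Continuous (sphereRetract (V := V)) := by
  refine Continuous.subtype_mk (Continuous.smul (Continuous.inv₀ (by fun_prop) fun v => ?_)
    (by fun_prop)) _
  exact norm_ne_zero_iff.2 v.2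

theorem sphereRetract_eq {v : ({0}ᶜ : Set V)} (h : ‖(v : V)‖ = 1) : (sphereRetract v : V) = v := by
  simp [sphereRetract, h]

instance : LocallyPathConnectedSpace (Metric.sphere (0 : V) 1) :=
  have := (isOpen_compl_singleton (x := (0 : V))).locallyPathConnectedSpace
  locallyPathConnectedSpace_of_retract
    (continuous_inclusion sphere_subset_compl_zero) continuous_sphereRetract
    fun x => Subtype.ext (sphereRetract_eq (mem_sphere_zero_iff_norm.1 x.2))

end Ball

section Sphere

variable [InnerProductSpace ℝ V]

open scoped RealInnerProductSpace

/-- The map `p` fixes the hemisphere and sends `V` into `V` minus the origin; normalising it pulls θ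
back to the simply connected space `V`. -/
theorem exists_lift_on_hemisphere (θ : C(Metric.sphere (0 : V) 1, Circle)) {e : V}
    (he : ‖e‖ = 1) :
    ∃ φ : V → ℝ, Continuous φ ∧
      ∀ x : Metric.sphere (0 : V) 1, 0 ≤ ⟪e, (x : V)⟫ → θ x = Circle.exp (φ x) := by
  let q : V → V := fun y => y - ⟪e, y⟫ • e
  -- The root is 0 once ‖q y‖ ≥ 1, and it is 1 where q y = 0, so `p` is defined everywhere and never
  -- vanishes.
  let p : V → V := fun y => q y + √(1 - ‖q y‖ ^ 2) • e
  have hqe : ∀ y, ⟪e, q y⟫ = 0 := fun y => by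
    simp [q, inner_sub_right, inner_smul_right, he]
  have hq : Continuous q := by fun_prop
  have hp : Continuous p := by fun_prop
  have hp0 : ∀ y, p y ∈ ({0}ᶜ : Set V) := fun y h => by
    rw [mem_singleton_iff] at h
    have h1 : √(1 - ‖q y‖ ^ 2) = 0 := by
      have := congrArg (fun v => ⟪e, v⟫) h
      simpa [p, inner_add_right, inner_smul_right, hqe, he] using this
    have h2 : q y = 0 := by simpa [p, h1] using h
    simp [h2] at h1
  have hpx : ∀ x : V, ‖x‖ = 1 → 0 ≤ ⟪e, x⟫ → p x = x := fun x hx hex => by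
    have h1 : ‖q x‖ ^ 2 = 1 - ⟪e, x⟫ ^ 2 := by
      rw [← real_inner_self_eq_norm_sq]
      simp only [q, inner_sub_left, inner_sub_right, inner_smul_left, inner_smul_right,
        real_inner_self_eq_norm_sq, hx, he, real_inner_comm e x]
      simp
      ring
    have h2 : √(1 - ‖q x‖ ^ 2) = ⟪e, x⟫ := by
      rw [h1, sub_sub_cancel, Real.sqrt_sq hex]
    simp [p, h2, q]
  have hg : Continuous fun y => θ (sphereRetract ⟨p y, hp0 y⟩) :=
    θ.continuous.comp (continuous_sphereRetract.comp (hp.subtype_mk hp0))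
  obtain ⟨φ, hφ⟩ := circleLifts_of_simplyConnected V ⟨_, hg⟩
  refine ⟨φ, φ.continuous, fun x hx => ?_⟩
  rw [← hφ]
  have hx1 := mem_sphere_zero_iff_norm.1 x.2
  have h3 := hpx x hx1 hx
  change θ x = θ (sphereRetract ⟨p x, hp0 x⟩)
  congr 1
  ext
  rw [sphereRetract_eq (show ‖p x‖ = 1 by rw [h3, hx1])]
  exact h3.symm

/-- The equator is the unit sphere of the hyperplane orthogonal to `e`, whose dimension is at least
2. -/
theorem isPreconnected_equator [FiniteDimensional ℝ V] (hV : 3 ≤ Module.finrank ℝ V) {e : V}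
    (he : ‖e‖ = 1) :
    IsPreconnected {x : Metric.sphere (0 : V) 1 | ⟪e, (x : V)⟫ = 0} := by
  have he0 : e ≠ 0 := fun h => by simp [h] at he
  obtain ⟨k, hk⟩ : ∃ k, Module.finrank ℝ V = k + 1 := ⟨Module.finrank ℝ V - 1, by omega⟩
  have : Fact (Module.finrank ℝ V = k + 1) := ⟨hk⟩
  have hrank : 1 < Module.rank ℝ (ℝ ∙ e)ᗮ := by
    rw [← Module.finrank_eq_rank, Submodule.finrank_orthogonal_span_singleton (n := k) he0]
    exact_mod_cast (by omega : 1 < k)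
  have hS := isPreconnected_sphere hrank 0 1
  have hpre : IsPreconnected (univ : Set (Metric.sphere (0 : (ℝ ∙ e)ᗮ) 1)) :=
    preconnectedSpace_iff_univ.1 (isPreconnected_iff_preconnectedSpace.1 hS)
  have himg := hpre.image (fun w => (⟨((w : (ℝ ∙ e)ᗮ) : V), by
    exact mem_sphere_zero_iff_norm.2 (mem_sphere_zero_iff_norm.1 w.2)⟩ : Metric.sphere (0 : V) 1)) (by fun_prop)
  convert himg using 1
  ext x
  simp only [mem_ofPred_eq, image_univ, mem_range]
  constructor
  · intro hx
    exact ⟨⟨⟨x, Submodule.mem_orthogonal_singleton_iff_inner_right.2 hx⟩, by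
      exact mem_sphere_zero_iff_norm.2 (mem_sphere_zero_iff_norm.1 x.2)⟩, rfl⟩
  · rintro ⟨w, rfl⟩
    exact Submodule.mem_orthogonal_singleton_iff_inner_right.1 w.1.2

/-- Lifts on the two hemispheres differ on the connected equator by one constant multiple of 2π;
after shifting by it they glue. -/
theorem circleLifts_sphere [FiniteDimensional ℝ V] (hV : 3 ≤ Module.finrank ℝ V) :
    CircleLifts (Metric.sphere (0 : V) 1) := by
  intro θ
  have : Nontrivial V := Module.nontrivial_of_finrank_pos (R := ℝ) (by omega)
  obtain ⟨e, he⟩ := exists_norm_eq V zero_le_one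
  obtain ⟨φ, hφ, hφθ⟩ := exists_lift_on_hemisphere θ he
  obtain ⟨ψ, hψ, hψθ⟩ := exists_lift_on_hemisphere θ (e := -e) (by rwa [norm_neg])
  set S : Set (Metric.sphere (0 : V) 1) := {x | ⟪e, (x : V)⟫ = 0} with hSdef
  have hpi := Real.pi_pos
  have hint : ∀ x ∈ S, ∃ m : ℤ, (φ x - ψ x) / (2 * Real.pi) = m := by
    intro x hx
    have h0 : ⟪e, (x : V)⟫ = 0 := hx
    have h1 := (hφθ x h0.ge).symm.trans (hψθ x (by rw [inner_neg_left, h0, neg_zero]))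
    obtain ⟨m, hm⟩ := Circle.exp_eq_exp.1 h1
    refine ⟨m, ?_⟩
    rw [hm]
    field_simp
    ring
  obtain ⟨m, hm⟩ : ∃ m : ℤ, ∀ x ∈ S, φ x = ψ x + m * (2 * Real.pi) := by
    rcases S.eq_empty_or_nonempty with hS | ⟨x₀, hx₀⟩
    · exact ⟨0, by simp [hS]⟩
    · obtain ⟨m, hm⟩ := hint x₀ hx₀
      refine ⟨m, fun x hx => ?_⟩
      have := eq_of_isPreconnected_of_int_valued (isPreconnected_equator hV he)
        (g := fun x => (φ x - ψ x) / (2 * Real.pi)) (by fun_prop) hint hx hx₀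
      rw [hm] at this
      field_simp at this
      linarith
  refine ⟨⟨fun x => if 0 ≤ ⟪e, (x : V)⟫ then φ x else ψ x + m * (2 * Real.pi), ?_⟩, fun x => ?_⟩
  · exact Continuous.if_le (by fun_prop) (by fun_prop) continuous_const (by fun_prop)
      fun x hx => hm x hx.symm
  · simp only [ContinuousMap.coe_mk]
    split_ifs with h
    · exact hφθ x h
    · rw [hψθ x (by rw [inner_neg_left]; linarith), Circle.exp_eq_exp]
      exact ⟨-m, by push_cast; ring⟩

end Sphere

end Lifts

open scoped RealInnerProductSpace

/-! ### Antipodal pairs in dimension at least three. -/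

section HigherDimensional

variable {V : Type*} [NormedAddCommGroup V] [InnerProductSpace ℝ V] [FiniteDimensional ℝ V]

theorem exists_antipodal_mem_contourAt (hV : 3 ≤ Module.finrank ℝ V)
    {f : Metric.closedBall (0 : V) 1 → ℝ} (hf : Continuous f) :
    ∃ x, ∃ u ∈ contourAt f x, ∃ v ∈ contourAt f x, ‖(u : V)‖ = 1 ∧ (v : V) = -u := by
  have : ProperSpace V := FiniteDimensional.proper ℝ V
  have hrank : 1 < Module.rank ℝ V := by
    rw [← Module.finrank_eq_rank]
    exact_mod_cast (by omega : 1 < Module.finrank ℝ V)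
  have : ConnectedSpace (Metric.sphere (0 : V) 1) :=
    isConnected_iff_connectedSpace.1 (isConnected_sphere hrank 0 zero_le_one)
  have hS := circleLifts_sphere hV
  let ι : Metric.sphere (0 : V) 1 → Metric.closedBall (0 : V) 1 :=
    inclusion Metric.sphere_subset_closedBall
  have hι : Continuous ι := continuous_inclusion _
  let R : Set (Metric.closedBall (0 : V) 1 × Metric.closedBall (0 : V) 1) :=
    {p | ‖(p.1 : V)‖ = 1 ∧ (p.2 : V) = -p.1}
  have hR : IsClosed R := (isClosed_eq (by fun_prop) (by fun_prop)).inter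
    (isClosed_eq (by fun_prop) (by fun_prop))
  have hanti : ∀ G, Disjoint (G ×ˢ G) R → ∀ s ∈ ι ⁻¹' G, -s ∉ ι ⁻¹' G := by
    intro G hG s hs hs'
    exact disjoint_left.1 hG (show (ι s, ι (-s)) ∈ G ×ˢ G from ⟨hs, hs'⟩)
      ⟨mem_sphere_zero_iff_norm.1 s.2, rfl⟩
  obtain ⟨x, hx⟩ := circleLifts_closedBall.exists_contourAt_rel hf hR
    -- The big component is the one containing the symmetric components of the sphere minus G ∪ -G,
    -- which all lie in one component of the sphere minus G. Symmetric components for a larger `G'`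
    -- sit inside symmetric ones for `G`.
    (fun G z => ∃ s, ι s = z ∧ -s ∈ connectedComponentIn (ι ⁻¹' G ∪ -(ι ⁻¹' G))ᶜ s)
    (fun G hG hGR => by
      obtain ⟨s, hs⟩ := hS.exists_neg_mem_connectedComponentIn (hG.preimage hι) (hanti G hGR)
      exact ⟨ι s, s, rfl, hs⟩)
    (by
      rintro G G' hG hG' hGR hGG' _ _ ⟨s, rfl, hs⟩ ⟨s', rfl, hs'⟩
      have hsub : ι ⁻¹' G ⊆ ι ⁻¹' G' := preimage_mono hGG'
      have h1 : -s' ∈ connectedComponentIn (ι ⁻¹' G ∪ -(ι ⁻¹' G))ᶜ s' :=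
        connectedComponentIn_mono s' (compl_subset_compl.2
          (union_subset_union hsub (neg_subset_neg.2 hsub))) hs'
      have h2 := hS.mem_connectedComponentIn_of_neg_mem (hG.preimage hι)
        (hanti G (hGR.mono_left (prod_mono hGG' hGG'))) hs h1
      have h3 : IsPreconnected (ι '' connectedComponentIn (ι ⁻¹' G)ᶜ s) :=
        isPreconnected_connectedComponentIn.image _ hι.continuousOn
      refine h3.subset_connectedComponentIn (mem_image_of_mem _
        (mem_connectedComponentIn (mem_of_mem_connectedComponentIn h2))) ?_ (mem_image_of_mem _ h2)
      rintro _ ⟨t, ht, rfl⟩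
      exact connectedComponentIn_subset (ι ⁻¹' G)ᶜ s ht)
  obtain ⟨⟨u, v⟩, ⟨hu, hv⟩, h⟩ := not_disjoint_iff.1 hx
  exact ⟨x, u, hu, v, hv, h⟩

end HigherDimensional

/-! ### Wide pairs in the disc. -/

section Plane

/-- Rotation by a quarter turn. -/
noncomputable def quarterTurn (v : EuclideanSpace ℝ (Fin 2)) : EuclideanSpace ℝ (Fin 2) :=
  !₂[-v 1, v 0]

theorem inner_fin_two (x y : EuclideanSpace ℝ (Fin 2)) : ⟪x, y⟫ = x 0 * y 0 + x 1 * y 1 := by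
  simp [PiLp.inner_apply, Fin.sum_univ_two, mul_comm]

theorem norm_sq_fin_two (x : EuclideanSpace ℝ (Fin 2)) : ‖x‖ ^ 2 = x 0 ^ 2 + x 1 ^ 2 := by
  rw [← real_inner_self_eq_norm_sq, inner_fin_two]; ring

theorem quarterTurn_zero (v : EuclideanSpace ℝ (Fin 2)) : quarterTurn v 0 = -v 1 := rfl

theorem quarterTurn_one (v : EuclideanSpace ℝ (Fin 2)) : quarterTurn v 1 = v 0 := rfl

theorem norm_quarterTurn (v : EuclideanSpace ℝ (Fin 2)) : ‖quarterTurn v‖ = ‖v‖ := by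
  rw [← sq_eq_sq₀ (norm_nonneg _) (norm_nonneg _), norm_sq_fin_two, norm_sq_fin_two,
    quarterTurn_zero, quarterTurn_one]
  ring

theorem inner_quarterTurn_self (v : EuclideanSpace ℝ (Fin 2)) : ⟪quarterTurn v, v⟫ = 0 := by
  rw [inner_fin_two, quarterTurn_zero, quarterTurn_one]; ring

theorem inner_decomp {v : EuclideanSpace ℝ (Fin 2)} (hv : ‖v‖ = 1)
    (x y : EuclideanSpace ℝ (Fin 2)) :
    ⟪x, y⟫ = ⟪x, v⟫ * ⟪y, v⟫ + ⟪x, quarterTurn v⟫ * ⟪y, quarterTurn v⟫ := by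
  have h := norm_sq_fin_two v
  rw [hv] at h
  simp only [inner_fin_two, quarterTurn_zero, quarterTurn_one]
  linear_combination (x 0 * y 0 + x 1 * y 1) * h

theorem eq_decomp {v : EuclideanSpace ℝ (Fin 2)} (hv : ‖v‖ = 1) (x : EuclideanSpace ℝ (Fin 2)) :
    x = ⟪x, v⟫ • v + ⟪x, quarterTurn v⟫ • quarterTurn v := by
  refine ext_inner_right ℝ fun y => ?_
  rw [inner_decomp hv x y, inner_add_left, inner_smul_left, inner_smul_left, real_inner_comm v y,
    real_inner_comm (quarterTurn v) y]
  simp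

theorem norm_sq_decomp {v : EuclideanSpace ℝ (Fin 2)} (hv : ‖v‖ = 1)
    (x : EuclideanSpace ℝ (Fin 2)) : ‖x‖ ^ 2 = ⟪x, v⟫ ^ 2 + ⟪x, quarterTurn v⟫ ^ 2 := by
  rw [← real_inner_self_eq_norm_sq, inner_decomp hv x x]; ring

/-- Two half-arcs, parametrised by the cosine c ∈ [-1, 1/2] of the angle to `v`, meet at -v. -/
theorem isPreconnected_arc {v : EuclideanSpace ℝ (Fin 2)} (hv : ‖v‖ = 1) :
    IsPreconnected {x : EuclideanSpace ℝ (Fin 2) | ‖x‖ = 1 ∧ ⟪x, v⟫ ≤ 1 / 2} := by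
  let g : ℝ → ℝ → EuclideanSpace ℝ (Fin 2) := fun ε c => c • v + (ε * √(1 - c ^ 2)) • quarterTurn v
  have hg : ∀ ε, IsPreconnected (g ε '' Icc (-1) (1 / 2)) := fun ε =>
    isPreconnected_Icc.image _ (by fun_prop)
  have hvq : ⟪v, quarterTurn v⟫ = 0 := by rw [real_inner_comm, inner_quarterTurn_self]
  have hqq : ⟪quarterTurn v, quarterTurn v⟫ = 1 := by
    rw [real_inner_self_eq_norm_sq, norm_quarterTurn, hv, one_pow]
  have hunion : {x : EuclideanSpace ℝ (Fin 2) | ‖x‖ = 1 ∧ ⟪x, v⟫ ≤ 1 / 2} =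
      g 1 '' Icc (-1) (1 / 2) ∪ g (-1) '' Icc (-1) (1 / 2) := by
    apply Subset.antisymm
    · rintro x ⟨hx, hxv⟩
      have hsq := norm_sq_decomp hv x
      rw [hx] at hsq
      have hmem : ⟪x, v⟫ ∈ Icc (-1 : ℝ) (1 / 2) := ⟨by nlinarith [sq_nonneg ⟪x, quarterTurn v⟫], hxv⟩
      have hsqrt : √(1 - ⟪x, v⟫ ^ 2) = |⟪x, quarterTurn v⟫| := by
        rw [← Real.sqrt_sq_eq_abs]
        congr 1
        linarith
      rcases le_total 0 ⟪x, quarterTurn v⟫ with h | h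
      · refine Or.inl ⟨_, hmem, ?_⟩
        simp only [g]
        rw [hsqrt, abs_of_nonneg h, one_mul, ← eq_decomp hv x]
      · refine Or.inr ⟨_, hmem, ?_⟩
        simp only [g]
        rw [hsqrt, abs_of_nonpos h, neg_one_mul, neg_neg, ← eq_decomp hv x]
    · have hsub : ∀ ε : ℝ, ε ^ 2 = 1 → g ε '' Icc (-1) (1 / 2) ⊆
          {x : EuclideanSpace ℝ (Fin 2) | ‖x‖ = 1 ∧ ⟪x, v⟫ ≤ 1 / 2} := by
        rintro ε hε _ ⟨c, hc, rfl⟩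
        have h1 : ⟪g ε c, v⟫ = c := by
          simp [g, inner_add_left, inner_smul_left, inner_quarterTurn_self, hv]
        have h2 : ⟪g ε c, quarterTurn v⟫ = ε * √(1 - c ^ 2) := by
          simp only [g, inner_add_left, inner_smul_left, hvq, hqq]
          simp
        refine ⟨?_, h1.le.trans hc.2⟩
        have h3 := norm_sq_decomp hv (g ε c)
        rw [h1, h2, mul_pow, hε, Real.sq_sqrt (by nlinarith [hc.1, hc.2])] at h3
        rw [← sq_eq_sq₀ (norm_nonneg _) zero_le_one, h3]
        ring
      exact union_subset (hsub 1 (by norm_num)) (hsub (-1) (by norm_num))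
  rw [hunion]
  refine (hg 1).union (-v) ⟨-1, by norm_num, ?_⟩ ⟨-1, by norm_num, ?_⟩ (hg (-1)) <;> simp [g]

theorem exists_mem_arc_inter (v w : EuclideanSpace ℝ (Fin 2)) (hv : ‖v‖ = 1) :
    ∃ x : EuclideanSpace ℝ (Fin 2), ‖x‖ = 1 ∧ ⟪x, v⟫ ≤ 1 / 2 ∧ ⟪x, w⟫ ≤ 1 / 2 := by
  rcases le_total ⟪quarterTurn v, w⟫ 0 with h | h
  · exact ⟨quarterTurn v, by rw [norm_quarterTurn, hv], by rw [inner_quarterTurn_self]; norm_num,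
      by linarith⟩
  · exact ⟨-quarterTurn v, by rw [norm_neg, norm_quarterTurn, hv],
      by rw [inner_neg_left, inner_quarterTurn_self]; norm_num, by rw [inner_neg_left]; linarith⟩

/-- Write C = cos α, S = sin α, p = cos t, q = sin t. The bounds say cos(t ± α) ≥ cos 2α, and the
claim is |t| ≤ |α|. The wrap-around case p ≤ -C is excluded by |α| < π/3, which is C > 1/2. -/
theorem le_of_arc_bounds {C S p q : ℝ} (hC : 1 / 2 < C) (hCS : C ^ 2 + S ^ 2 = 1)
    (hpq : p ^ 2 + q ^ 2 = 1) (h₁ : C ^ 2 - S ^ 2 ≤ C * p + S * q)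
    (h₂ : C ^ 2 - S ^ 2 ≤ C * p - S * q) : C ≤ p := by
  by_contra! hp
  have h3 : |S| * |q| ≤ C * p - (C ^ 2 - S ^ 2) := by
    rw [← abs_mul, abs_le]; constructor <;> linarith
  rcases le_or_gt p (-C) with h | h
  · have h4 : |q| ≤ |S| := sq_le_sq.1 (by nlinarith)
    have h5 : q ^ 2 ≤ |S| * |q| := by
      rw [← sq_abs q, sq]; exact mul_le_mul_of_nonneg_right h4 (abs_nonneg q)
    have h6 : -1 ≤ p := by nlinarith [sq_nonneg q]
    nlinarith
  · have h4 : |S| ≤ |q| := sq_le_sq.1 (by nlinarith)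
    have h5 : S ^ 2 ≤ |S| * |q| := by
      rw [← sq_abs S, sq]; exact mul_le_mul_of_nonneg_left h4 (abs_nonneg S)
    nlinarith

/-- A compact set of unit vectors of the plane with pairwise angles less than `2π/3` lies in an open
arc of length `2π/3`. -/
theorem exists_inner_gt_half {H : Set (EuclideanSpace ℝ (Fin 2))} (hH : IsCompact H)
    (hunit : ∀ x ∈ H, ‖x‖ = 1) (hinner : ∀ x ∈ H, ∀ y ∈ H, -(1 / 2) < ⟪x, y⟫) :
    ∃ v : EuclideanSpace ℝ (Fin 2), ‖v‖ = 1 ∧ ∀ x ∈ H, 1 / 2 < ⟪x, v⟫ := by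
  rcases H.eq_empty_or_nonempty with rfl | hne
  · obtain ⟨v, hv⟩ := exists_norm_eq (EuclideanSpace ℝ (Fin 2)) zero_le_one
    exact ⟨v, hv, by simp⟩
  -- Take `x`, `y` at the widest angle and let `v` be their bisector: ‖x + y‖/2 is the cosine of the
  -- half-angle, and it exceeds 1/2.
  obtain ⟨⟨x, y⟩, ⟨hx, hy⟩, hmin⟩ := (hH.prod hH).exists_isMinOn (hne.prod hne)
    (f := fun p : EuclideanSpace ℝ (Fin 2) × EuclideanSpace ℝ (Fin 2) => ⟪p.1, p.2⟫)
    (by fun_prop)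
  have hmin' : ∀ z ∈ H, ∀ w ∈ H, ⟪x, y⟫ ≤ ⟪z, w⟫ := fun z hz w hw => hmin (mk_mem_prod hz hw)
  have hxx : ⟪x, x⟫ = 1 := by rw [real_inner_self_eq_norm_sq, hunit x hx, one_pow]
  have hyy : ⟪y, y⟫ = 1 := by rw [real_inner_self_eq_norm_sq, hunit y hy, one_pow]
  set c := ⟪x, y⟫ with hc
  have hyx : ⟪y, x⟫ = c := real_inner_comm x y
  have hchalf : -(1 / 2) < c := hinner x hx y hy
  have hm2 : ‖x + y‖ ^ 2 = 2 + 2 * c := by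
    rw [← real_inner_self_eq_norm_sq, inner_add_left, inner_add_right, inner_add_right, hxx, hyy,
      hyx]
    ring
  have hm1 : 1 < ‖x + y‖ := by
    by_contra! h
    nlinarith [norm_nonneg (x + y)]
  have hm0 : ‖x + y‖ ≠ 0 := by linarith
  set v := ‖x + y‖⁻¹ • (x + y) with hv
  have hv1 : ‖v‖ = 1 := by rw [hv, norm_smul, norm_inv, norm_norm, inv_mul_cancel₀ hm0]
  have hxv : ⟪x, v⟫ = ‖x + y‖ / 2 := by
    rw [hv, inner_smul_right, inner_add_right, hxx]
    field_simp
    linarith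
  have hyv : ⟪y, v⟫ = ‖x + y‖ / 2 := by
    rw [hv, inner_smul_right, inner_add_right, hyy, hyx]
    field_simp
    linarith
  have hsum : ⟪y, quarterTurn v⟫ = -⟪x, quarterTurn v⟫ := by
    have h1 : x + y = ‖x + y‖ • v := by rw [hv, smul_smul, mul_inv_cancel₀ hm0, one_smul]
    have h2 : ⟪x + y, quarterTurn v⟫ = 0 := by
      rw [h1, inner_smul_left, real_inner_comm, inner_quarterTurn_self, mul_zero]
    rw [inner_add_left] at h2
    linarith
  refine ⟨v, hv1, fun z hz => ?_⟩
  have hxS := norm_sq_decomp hv1 x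
  have hzS := norm_sq_decomp hv1 z
  have hcS := inner_decomp hv1 x y
  have hzx := inner_decomp hv1 z x
  have hzy := inner_decomp hv1 z y
  have h1 := hmin' z hz x hx
  have h2 := hmin' z hz y hy
  rw [hunit x hx, hxv] at hxS
  rw [hunit z hz] at hzS
  rw [hsum, hxv, hyv] at hcS
  rw [hxv] at hzx
  rw [hsum, hyv] at hzy
  have := le_of_arc_bounds (C := ‖x + y‖ / 2) (S := ⟪x, quarterTurn v⟫) (p := ⟪z, v⟫)
    (q := ⟪z, quarterTurn v⟫) (by linarith) (by linarith) (by linarith)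
    (by nlinarith) (by nlinarith)
  linarith

/-- The closed arc of length `4π/3` opposite to `v`, as a subset of the unit disc. -/
def discArc (v : EuclideanSpace ℝ (Fin 2)) :
    Set (Metric.closedBall (0 : EuclideanSpace ℝ (Fin 2)) 1) :=
  {x | ‖(x : EuclideanSpace ℝ (Fin 2))‖ = 1 ∧ ⟪(x : EuclideanSpace ℝ (Fin 2)), v⟫ ≤ 1 / 2}

/-- The pairs of boundary points of the unit disc at angular distance at least `2π/3`. -/
def widePairs : Set (Metric.closedBall (0 : EuclideanSpace ℝ (Fin 2)) 1 ×
    Metric.closedBall (0 : EuclideanSpace ℝ (Fin 2)) 1) :=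
  {p | ‖(p.1 : EuclideanSpace ℝ (Fin 2))‖ = 1 ∧ ‖(p.2 : EuclideanSpace ℝ (Fin 2))‖ = 1 ∧
    ⟪(p.1 : EuclideanSpace ℝ (Fin 2)), (p.2 : EuclideanSpace ℝ (Fin 2))⟫ ≤ -(1 / 2)}

theorem isClosed_widePairs : IsClosed widePairs := by
  have h₁ : Continuous fun p : Metric.closedBall (0 : EuclideanSpace ℝ (Fin 2)) 1 ×
      Metric.closedBall (0 : EuclideanSpace ℝ (Fin 2)) 1 => (p.1 : EuclideanSpace ℝ (Fin 2)) :=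
    continuous_subtype_val.comp continuous_fst
  have h₂ : Continuous fun p : Metric.closedBall (0 : EuclideanSpace ℝ (Fin 2)) 1 ×
      Metric.closedBall (0 : EuclideanSpace ℝ (Fin 2)) 1 => (p.2 : EuclideanSpace ℝ (Fin 2)) :=
    continuous_subtype_val.comp continuous_snd
  have h₃ := isClosed_le (h₁.inner (𝕜 := ℝ) h₂) (continuous_const (y := -(1 / 2 : ℝ)))
  exact (isClosed_eq h₁.norm continuous_const).inter
    ((isClosed_eq h₂.norm continuous_const).inter h₃)

theorem isPreconnected_discArc {v : EuclideanSpace ℝ (Fin 2)} (hv : ‖v‖ = 1) :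
    IsPreconnected (discArc v) := by
  rw [← Topology.IsInducing.subtypeVal.isPreconnected_image]
  convert isPreconnected_arc hv using 1
  ext x
  constructor
  · rintro ⟨x, hx, rfl⟩
    exact hx
  · intro hx
    exact ⟨⟨x, mem_closedBall_zero_iff.2 hx.1.le⟩, hx, rfl⟩

theorem exists_mem_discArc_inter {v w : EuclideanSpace ℝ (Fin 2)} (hv : ‖v‖ = 1) :
    ∃ x, x ∈ discArc v ∧ x ∈ discArc w := by
  obtain ⟨x, hx, hxv, hxw⟩ := exists_mem_arc_inter v w hv
  exact ⟨⟨x, mem_closedBall_zero_iff.2 hx.le⟩, ⟨hx, hxv⟩, ⟨hx, hxw⟩⟩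

theorem exists_disjoint_discArc {G : Set (Metric.closedBall (0 : EuclideanSpace ℝ (Fin 2)) 1)}
    (hG : IsClosed G) (hGR : Disjoint (G ×ˢ G) widePairs) :
    ∃ v : EuclideanSpace ℝ (Fin 2), ‖v‖ = 1 ∧ Disjoint (discArc v) G := by
  have hN : IsClosed {x : Metric.closedBall (0 : EuclideanSpace ℝ (Fin 2)) 1 |
      ‖(x : EuclideanSpace ℝ (Fin 2))‖ = 1} :=
    isClosed_eq continuous_subtype_val.norm continuous_const
  obtain ⟨v, hv, hGv⟩ := exists_inner_gt_half
    ((hG.inter hN).isCompact.image continuous_subtype_val)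
    (by rintro _ ⟨x, hx, rfl⟩; exact hx.2)
    (by
      rintro _ ⟨x, hx, rfl⟩ _ ⟨y, hy, rfl⟩
      by_contra! h
      exact disjoint_left.1 hGR (mk_mem_prod hx.1 hy.1) ⟨hx.2, hy.2, h⟩)
  refine ⟨v, hv, disjoint_left.2 fun y hy hyG => ?_⟩
  exact absurd (hGv _ ⟨y, ⟨hyG, hy.1⟩, rfl⟩) (not_lt.2 hy.2)

theorem exists_wide_pair_mem_contourAt
    {f : Metric.closedBall (0 : EuclideanSpace ℝ (Fin 2)) 1 → ℝ} (hf : Continuous f) :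
    ∃ x, ∃ u ∈ contourAt f x, ∃ v ∈ contourAt f x, (u, v) ∈ widePairs := by
  obtain ⟨x, hx⟩ := circleLifts_closedBall.exists_contourAt_rel hf isClosed_widePairs
    -- The big component contains every arc of length 4π/3 that misses `G`; any two such arcs meet,
    -- so they lie in the same component.
    (fun G z => ∃ v, ‖v‖ = 1 ∧ z ∈ discArc v ∧ Disjoint (discArc v) G)
    (fun G hG hGR => by
      obtain ⟨v, hv, hvG⟩ := exists_disjoint_discArc hG hGR
      obtain ⟨x, hx, -⟩ := exists_mem_discArc_inter (w := v) hv
      exact ⟨x, v, hv, hx, hvG⟩)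
    (by
      rintro G G' hG hG' hGR hGG' z z' ⟨v, hv, hz, hvG⟩ ⟨w, hw, hz', hwG⟩
      obtain ⟨x, hxv, hxw⟩ := exists_mem_discArc_inter (w := w) hv
      have hpre : IsPreconnected (discArc v ∪ discArc w) :=
        (isPreconnected_discArc hv).union x hxv hxw (isPreconnected_discArc hw)
      exact hpre.subset_connectedComponentIn (Or.inl hz)
        (union_subset (disjoint_left.1 hvG) (disjoint_left.1 (hwG.mono_right hGG'))) (Or.inr hz'))
  obtain ⟨⟨u, v⟩, ⟨hu, hv⟩, h⟩ := not_disjoint_iff.1 hx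
  exact ⟨x, u, hu, v, hv, h⟩

end Plane

/-! ### From pairs of boundary points to diameters. -/

theorem theorem6p2 (n : ℕ) (hn : 2 ≤ n) (f : unitBall n → ℝ) (hf : Continuous f) :
    ∃ C : Set (unitBall n), IsContour f C ∧
      (n = 2 → √3 ≤ Metric.diam (Subtype.val '' C ∩ frontier (unitBall n))) ∧
      (3 ≤ n → Metric.diam (Subtype.val '' C ∩ frontier (unitBall n)) = 2) := by
  have hfr : frontier (unitBall n) = Metric.sphere 0 1 := frontier_closedBall _ one_ne_zero
  have hbdd : ∀ C : Set (unitBall n),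
      Bornology.IsBounded (Subtype.val '' C ∩ frontier (unitBall n)) := fun C =>
    Metric.isBounded_sphere.subset (inter_subset_right.trans hfr.subset)
  have hmem : ∀ (C : Set (unitBall n)) (u : unitBall n), u ∈ C →
      ‖(u : EuclideanSpace ℝ (Fin n))‖ = 1 →
      (u : EuclideanSpace ℝ (Fin n)) ∈ Subtype.val '' C ∩ frontier (unitBall n) :=
    fun C u hu hu1 => ⟨mem_image_of_mem _ hu, hfr ▸ mem_sphere_zero_iff_norm.2 hu1⟩
  rcases hn.eq_or_lt with rfl | hn3
  · obtain ⟨x, u, hu, v, hv, ⟨hu1, hv1, huv⟩⟩ := exists_wide_pair_mem_contourAt hf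
    refine ⟨contourAt f x, isContour_contourAt f x, fun _ => ?_, fun h => by omega⟩
    refine le_trans ?_ (Metric.dist_le_diam_of_mem (hbdd _) (hmem _ u hu hu1) (hmem _ v hv hv1))
    rw [dist_eq_norm]
    refine Real.sqrt_le_iff.2 ⟨norm_nonneg _, ?_⟩
    -- For unit vectors ‖u - v‖² = 2 - 2⟪u, v⟫, which is at least 3 when ⟪u, v⟫ ≤ -1/2.
    rw [norm_sub_sq_real, hu1, hv1]
    linarith
  · obtain ⟨x, u, hu, v, hv, hu1, huv⟩ := exists_antipodal_mem_contourAt (by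
      rw [finrank_euclideanSpace_fin]; exact hn3) hf
    refine ⟨contourAt f x, isContour_contourAt f x, fun h => by omega, fun _ => le_antisymm ?_ ?_⟩
    · refine (Metric.diam_mono (inter_subset_right.trans
        (hfr.subset.trans Metric.sphere_subset_closedBall)) Metric.isBounded_closedBall).trans ?_
      simpa using Metric.diam_closedBall (x := (0 : EuclideanSpace ℝ (Fin n))) zero_le_one
    · refine le_trans (le_of_eq ?_) (Metric.dist_le_diam_of_mem (hbdd _) (hmem _ u hu hu1)
        (hmem _ v hv (by rw [huv, norm_neg, hu1])))
      rw [huv, dist_eq_norm, sub_neg_eq_add, ← two_smul ℝ, norm_smul, hu1]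
      norm_num
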